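/- Let $X$ be an infinite discrete space and let $G=S(X)$ be the group of all permutations of $X$ with the topology $\tau_p$ of pointwise convergence. Let $\alpha X=X\cup\{\infty\}$ be the Alexandroff one-point compactification of $X$, on which $G$ acts fixing $\infty$. Terminology. A $G$-compactification of a $G$-space $Z$ is a compact Hausdorff space $K$ with a jointly continuous action of $G$ and an equivariant dense topological embedding $b:Z\to K$; it is identified with $(K',b')$ if there is a homeomorphism $\varphi:K\to K'$ with $\varphi\circ b=b'$, and $(K,b)\le (K',b')$ means that there is a continuous $\varphi:K'\to K$ with $\varphi\circ b'=b$. An Ellis compactification of $G$ is a $G$-compactification $(S,b)$ of $G$ ($G$ acting on itself by left translations) together with a monoid structure on $S$ such that all right translations $s\mapsto st$ are continuous and $g\cdot s=b(g)s$ for $g\in G$, $s\in S$. It is an sm-compactification if the multiplication of $S$ is separately continuous, and a sim-compactification if, in addition, every $s\in S$ has a unique $s^*\in S$ with $ss^*s=s$ and $s^*ss^*=s^*$, and $s\mapsto s^*$ is continuous. The WAP-compactification of $G$ is the greatest sm-compactification of $G$. $e_{\alpha X}G$ is the closure of (the image of) $G$ in the monoid $(\alpha X)^{\alpha X}$ of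 self-maps of $\alpha X$ under composition, with the topology of pointwise convergence. The Roelcke uniformity of $G$ is the finest uniformity coarser than both the left and the right uniformity; $G$ is Roelcke precompact if it is totally bounded; the Roelcke compactification $b_rG$ is the Samuel compactification of $G$ with the Roelcke uniformity, i.e. the completion of $G$ in the finest totally bounded uniformity coarser than the Roelcke uniformity. The symmetric inverse semigroup $I_X$ is the monoid of all bijections between subsets of $X$, under composition of partial maps. Then: (a) $\alpha X$ is a $G$-compactification of $X$, and every $G$-compactification of $X$ coincides with it (by an equivariant homeomorphism that is the identity on $X$). (b) $G$ is Roelcke precompact, and $e_{\alpha X}G=b_rG$ as compactifications of $G$; $b_rG$ carries the monoid structure of $e_{\alpha X}G$. (c) Under this identification, $b_rG$ is the set, with the topology of pointwise convergence, of all self-maps $f$ of $\alpha X$ for which there is a subset $Y\subset X$ such that $f$ maps $Y$ bijectively onto a subset of $X$ and $f(\alpha X\setminus Y)\subset\{\infty\}$. (d) $b_rG$ is a sim-compactification of $G$, it is isomorphic as a monoid to $I_X$, and it is the WAP-compactification of $G$. -/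

import Mathlib

open Set Filter Topology

universe u v w x

/-! ### Topology of pointwise convergence -/

/-- The topology of pointwise convergence on a group `G` acting on a space `X`; its subbase consists
of the sets `{g | g • x ∈ O}` with `x : X` and `O` open in `X`. -/
@[reducible] def pointwiseTopology (G : Type u) (X : Type v) [SMul G X] [TopologicalSpace X] :
    TopologicalSpace G :=
  TopologicalSpace.induced (fun (g : G) (x : X) => g • x) Pi.topologicalSpace

/-- The permutation group `S(X)` carries the topology of pointwise convergence. -/
instance permTopology (X : Type u) [TopologicalSpace X] : TopologicalSpace (Equiv.Perm X) :=
  pointwiseTopology (Equiv.Perm X) X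

theorem perm_continuous_apply {X : Type u} [TopologicalSpace X] (x : X) :
    Continuous fun g : Equiv.Perm X => g x :=
  (continuous_apply x).comp
    (continuous_induced_dom (f := fun (g : Equiv.Perm X) (x : X) => g • x))

theorem perm_continuous_iff {X : Type u} [TopologicalSpace X] {Y : Type v} [TopologicalSpace Y]
    {f : Y → Equiv.Perm X} : Continuous f ↔ ∀ x, Continuous fun y => f y x := by
  rw [continuous_induced_rng, continuous_pi_iff]
  rfl

instance permTopologicalGroup (X : Type u) [TopologicalSpace X] [DiscreteTopology X] :
    IsTopologicalGroup (Equiv.Perm X) where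
  continuous_mul := by
    rw [perm_continuous_iff]
    intro x
    rw [continuous_discrete_rng]
    intro y
    have h : (fun p : Equiv.Perm X × Equiv.Perm X => (p.1 * p.2) x) ⁻¹' {y} =
        ⋃ z : X, {p | p.2 x = z} ∩ {p | p.1 z = y} := by
      ext p; simp
    rw [h]
    refine isOpen_iUnion fun z => IsOpen.inter ?_ ?_
    · exact (isOpen_discrete {z}).preimage ((perm_continuous_apply x).comp continuous_snd)
    · exact (isOpen_discrete {y}).preimage ((perm_continuous_apply z).comp continuous_fst)
  continuous_inv := by
    rw [perm_continuous_iff]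
    intro x
    rw [continuous_discrete_rng]
    intro y
    have h : (fun g : Equiv.Perm X => g⁻¹ x) ⁻¹' {y} = {g | g y = x} := by
      ext g
      change g.symm x = y ↔ g y = x
      rw [Equiv.symm_apply_eq, eq_comm]
    rw [h]
    exact (isOpen_discrete {x}).preimage (perm_continuous_apply y)

/-! ### The action of `S(X)` on the one-point compactification -/

/-- Permutations of `X` act on the one-point compactification of `X` and fix the point at
infinity. -/
instance permActionOnePoint (X : Type u) : MulAction (Equiv.Perm X) (OnePoint X) where
  smul g p := OnePoint.map g p
  one_smul p := by
    change OnePoint.map (id : X → X) p = p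
    simp
  mul_smul g h p := by
    change OnePoint.map ((g : X → X) ∘ (h : X → X)) p = _
    rw [OnePoint.map_comp]
    rfl

instance permContinuousOnePoint (X : Type u) [TopologicalSpace X] [DiscreteTopology X] :
    ContinuousConstSMul (Equiv.Perm X) (OnePoint X) where
  continuous_const_smul g := by
    change Continuous (OnePoint.map (g : X → X))
    refine OnePoint.continuous_map continuous_of_discreteTopology ?_
    rw [coclosedCompact_eq_cocompact, cocompact_eq_cofinite]
    exact g.injective.tendsto_cofinite

/-! ### Equivariant compactifications -/

/-- `(K, b)` is a `G`-compactification of the `G`-space `X`: `K` is a compact Hausdorff space with a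
(jointly) continuous action of `G`, and `b : X → K` is an equivariant dense embedding. -/
structure IsGCompactification (G : Type u) {X : Type v} {K : Type w} [Group G] [TopologicalSpace G]
    [TopologicalSpace X] [MulAction G X] [TopologicalSpace K] [MulAction G K] (b : X → K) :
    Prop where
  compactSpace : CompactSpace K
  t2Space : T2Space K
  continuousSMul : ContinuousSMul G K
  isEmbedding : IsEmbedding b
  denseRange : DenseRange b
  map_smul : ∀ (g : G) (x : X), b (g • x) = g • b x

/-- The order on compactifications: `(K, b) ≤ (K', b')` iff there is a continuous map
`φ : K' → K` with `φ ∘ b' = b`. -/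
def CompactificationLE {X : Type u} {K : Type v} {K' : Type w} [TopologicalSpace K]
    [TopologicalSpace K'] (b : X → K) (b' : X → K') : Prop :=
  ∃ φ : K' → K, Continuous φ ∧ φ ∘ b' = b

/-! ### Semigroup compactifications of a topological group -/

/-- `(S, b)` is an Ellis compactification of `G`: it is a `G`-compactification of `G` (with `G`
acting on itself by left translations), `S` is a monoid in which every right translation
`s ↦ s * t` is continuous, and the extended action of `G` on `S` is the restriction of the
multiplication of `S` to `G × S`. -/
structure IsEllisCompactification {G : Type u} {S : Type v} [Group G] [TopologicalSpace G]
    [Monoid S] [TopologicalSpace S] (b : G → S) : Prop where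
  isGCompactification : ∃ _ : MulAction G S,
    IsGCompactification G b ∧ ∀ (g : G) (s : S), g • s = b g * s
  continuous_mul_right : ∀ t : S, Continuous fun s : S => s * t

/-- An sm-compactification: an Ellis compactification which is a semitopological monoid, that is,
the multiplication is separately continuous. -/
structure IsSmCompactification {G : Type u} {S : Type v} [Group G] [TopologicalSpace G]
    [Monoid S] [TopologicalSpace S] (b : G → S) : Prop extends IsEllisCompactification b where
  continuous_mul_left : ∀ s : S, Continuous fun t : S => s * t

/-- A sim-compactification: an sm-compactification which is an inverse monoid (every element `s` has
a unique inverse `inv s` in the sense of semigroups) with continuous inversion. -/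
structure IsSimCompactification {G : Type u} {S : Type v} [Group G] [TopologicalSpace G]
    [Monoid S] [TopologicalSpace S] (b : G → S) : Prop extends IsSmCompactification b where
  exists_inv : ∃ inv : S → S, Continuous inv ∧
    ∀ s t : S, (s * t * s = s ∧ t * s * t = t) ↔ t = inv s

/-- The WAP-compactification of `G`: the greatest sm-compactification of `G`. -/
structure IsWAPCompactification {G : Type u} {S : Type v} [Group G] [TopologicalSpace G]
    [Monoid S] [TopologicalSpace S] (b : G → S) : Prop extends IsSmCompactification b where
  greatest : ∀ (T : Type w) [Monoid T] [TopologicalSpace T] (c : G → T),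
    IsSmCompactification c → CompactificationLE c b

/-! ### The Ellis compactification of a group acting on a space -/

/-- Self-maps of `K` carry the topology of pointwise convergence. -/
instance endTopology (K : Type u) [TopologicalSpace K] : TopologicalSpace (Function.End K) :=
  inferInstanceAs (TopologicalSpace (K → K))

theorem end_continuous_mul_right {K : Type u} [TopologicalSpace K] (h : Function.End K) :
    Continuous fun f : Function.End K => f * h :=
  continuous_pi fun x => continuous_apply (A := fun _ : K => K) (h x)

/-- The Ellis compactification `e_K G`: the closure in `K ^ K` (self-maps of `K` under composition,
with the topology of pointwise convergence) of the image of `G`. -/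
def EllisCompactification (G : Type u) (K : Type v) [Group G] [TopologicalSpace K] [MulAction G K]
    [ContinuousConstSMul G K] : Submonoid (Function.End K) where
  carrier := closure (range fun g : G => (MulAction.toEndHom g : Function.End K))
  one_mem' := subset_closure ⟨1, map_one _⟩
  mul_mem' {f h} hf hh := by
    have key : ∀ g : G, (MulAction.toEndHom g : Function.End K) * h ∈
        closure (range fun g : G => (MulAction.toEndHom g : Function.End K)) := by
      intro g
      have hc : Continuous fun k : Function.End K => (MulAction.toEndHom g : Function.End K) * k :=
        continuous_pi fun x =>
          (continuous_const_smul g).comp (continuous_apply (A := fun _ : K => K) x)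
      refine map_mem_closure hc hh ?_
      rintro _ ⟨g', rfl⟩
      exact ⟨g * g', map_mul _ _ _⟩
    have h2 := map_mem_closure (end_continuous_mul_right h) hf
      (t := closure (range fun g : G => (MulAction.toEndHom g : Function.End K)))
      (by rintro _ ⟨g, rfl⟩; exact key g)
    rwa [closure_closure] at h2

/-- The canonical map `G → e_K G`. -/
def ellisMap (G : Type u) (K : Type v) [Group G] [TopologicalSpace K] [MulAction G K]
    [ContinuousConstSMul G K] (g : G) : EllisCompactification G K :=
  ⟨MulAction.toEndHom g, subset_closure ⟨g, rfl⟩⟩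

/-! ### The Roelcke uniformity and the Roelcke compactification -/

/-- The Roelcke uniformity: the finest uniformity that is coarser than both the left and the right
uniformity. (In Mathlib `u ≤ v` means that `u` is finer than `v`.) -/
@[reducible] def roelckeUniformSpace (G : Type u) [Group G] [TopologicalSpace G]
    [IsTopologicalGroup G] : UniformSpace G :=
  IsTopologicalGroup.leftUniformSpace G ⊔ IsTopologicalGroup.rightUniformSpace G

/-- `G` is Roelcke precompact if its Roelcke uniformity is totally bounded. -/
def IsRoelckePrecompact (G : Type u) [Group G] [TopologicalSpace G] [IsTopologicalGroup G] : Prop :=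
  @TotallyBounded G (roelckeUniformSpace G) univ

/-- The precompact replica of a uniformity: the finest totally bounded uniformity coarser than
it. -/
@[reducible] def precompactReplica {α : Type u} (𝒰 : UniformSpace α) : UniformSpace α :=
  sInf {𝒱 : UniformSpace α | 𝒰 ≤ 𝒱 ∧ @TotallyBounded α 𝒱 univ}

/-- The Roelcke compactification `b_r G`: the Samuel compactification of `G` with the Roelcke
uniformity, i.e. the (Hausdorff) completion of its precompact replica. -/
def RoelckeCompactification (G : Type u) [Group G] [TopologicalSpace G] [IsTopologicalGroup G] :
    Type u :=
  @UniformSpace.Completion G (precompactReplica (roelckeUniformSpace G))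

instance roelckeCompactificationUniformSpace (G : Type u) [Group G] [TopologicalSpace G]
    [IsTopologicalGroup G] : UniformSpace (RoelckeCompactification G) :=
  @UniformSpace.Completion.uniformSpace G (precompactReplica (roelckeUniformSpace G))

/-- The canonical map `G → b_r G`. -/
def roelckeMap (G : Type u) [Group G] [TopologicalSpace G] [IsTopologicalGroup G] (g : G) :
    RoelckeCompactification G :=
  @UniformSpace.Completion.coe' G (precompactReplica (roelckeUniformSpace G)) g

/-! ### The symmetric inverse semigroup -/

/-- The symmetric inverse semigroup `I_X`: all bijections between subsets of `X`. -/
def SymmetricInverseSemigroup (X : Type u) : Type u := X ≃. X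

/-- The product `f * g` in `I_X` is the composition of partial maps `f ∘ g` (first `g`,
then `f`). -/
instance symmetricInverseMonoid (X : Type u) : Monoid (SymmetricInverseSemigroup X) where
  mul f g := PEquiv.trans (α := X) (β := X) (γ := X) g f
  one := PEquiv.refl X
  mul_assoc f g h := (PEquiv.trans_assoc (α := X) (β := X) (γ := X) (δ := X) h g f).symm
  one_mul f := PEquiv.trans_refl (α := X) (β := X) f
  mul_one f := PEquiv.refl_trans (α := X) (β := X) f

/-! ### Finite partial injections extend to permutations -/

/-! Everything rests on the fact that an injection defined on a finite subset of `X` extends to a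
permutation.

The closure of `G` in the self-maps of `αX`: fixing `∞` and taking each value in `X` at most once on
`X` are closed conditions satisfied by permutations. Conversely, a map satisfying them is
approximated on a finite set by keeping its values in `X`, sending the remaining points injectively
far out, and extending (`IsPartialInjection.mem_closure`). These maps are the partial bijections, so
the closure is `I_X`; inversion is continuous because `f* y = x` means `f x = y`, a clopen
condition.

Uniqueness of `αX`: two distinct points of the remainder would have disjoint neighbourhoods, but
transpositions of far-out points are close to the identity and carry points near one to points near
the other.

Roelcke uniformity: the double coset of `g` by the stabilizer of a finite `F` depends only on the
partial map `g` induces from `F` to `F` (`exists_stabilizer_mul_eq`). Hence this uniformity is that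
of pointwise convergence on `αX`; it is totally bounded and its completion is the compact closure
above.

Maximality: an sm-compactification `c` extends to the closure once it has one cluster point at each
`f` (`eq_of_clusterPt_ellis`). Two cluster points would yield permutations `h i` and `σ j` for which
the two iterated limits of `c (h i) * c (σ j)` lie in disjoint closed sets, whereas separate
continuity makes them equal (`not_disjoint_of_double_limit`). -/

theorem exists_perm_eqOn {X : Type u} (s : Finset X) {f : X → X} (hf : InjOn f s) :
    ∃ g : Equiv.Perm X, ∀ a ∈ s, g a = f a := by
  obtain ⟨g, hg⟩ := Equiv.Perm.exists_extending_pair (fun a : s => (a : X)) (fun a : s => f a)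
    Subtype.val_injective hf.injective
  exact ⟨g, fun a ha => hg ⟨a, ha⟩⟩

/-! ### The one-point compactification of a discrete space -/

section OnePoint

@[simp] theorem perm_smul_coe {X : Type u} (g : Equiv.Perm X) (x : X) :
    g • (x : OnePoint X) = ((g x : X) : OnePoint X) := rfl

variable {X : Type u} [TopologicalSpace X] [DiscreteTopology X]

theorem isClopen_singleton_coe (x : X) : IsClopen ({(x : OnePoint X)} : Set (OnePoint X)) := by
  refine ⟨isClosed_singleton, ?_⟩
  have := OnePoint.isOpen_image_coe.2 (isOpen_discrete ({x} : Set X))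
  simpa using this

/-- Basic neighbourhoods of `∞` are complements of finite subsets of `X`, so only finitely many
clopen conditions are at stake at each point. -/
theorem continuous_onePoint_of_isClopen {Y : Type v} [TopologicalSpace Y] {f : Y → OnePoint X}
    (hf : ∀ x : X, IsClopen (f ⁻¹' {(x : OnePoint X)})) : Continuous f := by
  rw [continuous_iff_continuousAt]
  intro y
  rcases hy : f y with _ | x
  · change f y = OnePoint.infty at hy
    rw [ContinuousAt, hy, OnePoint.hasBasis_nhds_infty.tendsto_right_iff]
    rintro s ⟨-, hs⟩
    have hfin : s.Finite := hs.finite_of_discrete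
    have : ∀ᶠ z in 𝓝 y, ∀ x ∈ s, f z ≠ (x : OnePoint X) := by
      rw [hfin.eventually_all]
      intro x _
      refine (hf x).1.isOpen_compl.mem_nhds ?_
      simp [hy]
    filter_upwards [this] with z hz
    rcases hz' : f z with _ | x
    · exact Or.inr rfl
    · exact Or.inl ⟨x, fun hx => hz x hx hz', rfl⟩
  · change f y = (x : OnePoint X) at hy
    have h : ∀ᶠ z in 𝓝 y, f z = x := (hf x).2.mem_nhds hy
    exact tendsto_nhds_of_eventually_eq (by rw [hy]; exact h)

theorem isClopen_eval_coe (p : OnePoint X) (x : X) :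
    IsClopen {f : Function.End (OnePoint X) | f p = (x : OnePoint X)} :=
  (isClopen_singleton_coe x).preimage (continuous_apply (A := fun _ : OnePoint X => OnePoint X) p)

theorem perm_isClopen_apply_eq (x y : X) : IsClopen {g : Equiv.Perm X | g x = y} :=
  (isClopen_discrete {y}).preimage (perm_continuous_apply x)

theorem perm_smul_eq_coe_iff {X : Type u} (g : Equiv.Perm X) (p : OnePoint X) (z : X) :
    g • p = (z : OnePoint X) ↔ p = ((g⁻¹ z : X) : OnePoint X) := by
  rw [← eq_inv_smul_iff, perm_smul_coe]

/-- With `w = g⁻¹ z`, the condition `g • p = z` becomes `p = w`. Since `g w = z` and `p = w` are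
both clopen, the condition and its negation are unions over `w` of open sets. -/
instance perm_continuousSMul_onePoint : ContinuousSMul (Equiv.Perm X) (OnePoint X) := by
  refine ⟨continuous_onePoint_of_isClopen fun z => ⟨⟨?_⟩, ?_⟩⟩
  · have : ((fun q : Equiv.Perm X × OnePoint X => q.1 • q.2) ⁻¹' {(z : OnePoint X)})ᶜ =
        ⋃ w : X, {q | q.1 w = z} ∩ {q | q.2 = (w : OnePoint X)}ᶜ := by
      ext ⟨g, p⟩
      simp only [mem_compl_iff, mem_preimage, mem_singleton_iff, perm_smul_eq_coe_iff, mem_iUnion,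
        mem_inter_iff, mem_ofPred_eq]
      constructor
      · exact fun h => ⟨g⁻¹ z, by simp, h⟩
      · rintro ⟨w, rfl, h⟩
        simpa using h
    rw [this]
    exact isOpen_iUnion fun w => ((perm_isClopen_apply_eq w z).preimage continuous_fst).2.inter
      ((isClopen_singleton_coe w).preimage continuous_snd).compl.2
  · have : ((fun q : Equiv.Perm X × OnePoint X => q.1 • q.2) ⁻¹' {(z : OnePoint X)}) =
        ⋃ w : X, {q | q.1 w = z} ∩ {q | q.2 = (w : OnePoint X)} := by
      ext ⟨g, p⟩
      simp only [mem_preimage, mem_singleton_iff, perm_smul_eq_coe_iff, mem_iUnion,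
        mem_inter_iff, mem_ofPred_eq]
      constructor
      · exact fun h => ⟨g⁻¹ z, by simp, h⟩
      · rintro ⟨w, rfl, h⟩
        simpa using h
    rw [this]
    exact isOpen_iUnion fun w => ((perm_isClopen_apply_eq w z).preimage continuous_fst).2.inter
      ((isClopen_singleton_coe w).preimage continuous_snd).2

/-- An open set with trace `{x}` on `X` contains only `b x`: the rest of it would be open and miss
the dense image. -/
theorem isOpen_singleton_of_dense_embedding {Y : Type w} [TopologicalSpace Y] [T2Space Y]
    {b : X → Y} (hb : IsEmbedding b) (hd : DenseRange b) (x : X) : IsOpen ({b x} : Set Y) := by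
  obtain ⟨U, hU, hUx⟩ := hb.isOpen_iff.1 (isOpen_discrete ({x} : Set X))
  have hxU : b x ∈ U := by
    have : x ∈ b ⁻¹' U := by rw [hUx]; rfl
    exact this
  suffices U = {b x} by rwa [← this]
  refine Subset.antisymm (fun y hy => ?_) (singleton_subset_iff.2 hxU)
  by_contra hne
  obtain ⟨z, hz⟩ := hd.exists_mem_open (hU.inter isOpen_compl_singleton) ⟨y, hy, hne⟩
  have : z ∈ b ⁻¹' U := hz.1
  rw [hUx] at this
  exact hz.2 (congrArg b this)

/-- Neighbourhoods of the identity contain pointwise stabilizers of finite sets. -/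
theorem exists_finset_of_mem_nhds_one {X : Type u} [TopologicalSpace X] {S : Set (Equiv.Perm X)}
    (hS : S ∈ 𝓝 (1 : Equiv.Perm X)) :
    ∃ F : Finset X, ∀ g : Equiv.Perm X, (∀ x ∈ F, g x = x) → g ∈ S := by
  rw [nhds_induced, mem_comap] at hS
  obtain ⟨t, ht, hts⟩ := hS
  rw [nhds_pi, Filter.mem_pi] at ht
  obtain ⟨I, hI, V, hV, hVt⟩ := ht
  refine ⟨hI.toFinset, fun g hg => hts (hVt fun x hx => ?_)⟩
  have h1 : g • x = (1 : Equiv.Perm X) • x := hg x (hI.mem_toFinset.2 hx)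
  exact (h1 ▸ mem_of_mem_nhds (hV x) : g • x ∈ V x)

variable [Infinite X]

theorem noncompactSpace_of_infinite_discrete : NoncompactSpace X :=
  ⟨fun h => infinite_univ h.finite_of_discrete⟩

theorem isGCompactification_onePoint :
    IsGCompactification (Equiv.Perm X) (fun x : X => (x : OnePoint X)) where
  compactSpace := inferInstance
  t2Space := inferInstance
  continuousSMul := inferInstance
  isEmbedding := OnePoint.isOpenEmbedding_coe.isEmbedding
  denseRange :=
    haveI : NoncompactSpace X := noncompactSpace_of_infinite_discrete
    OnePoint.denseRange_coe
  map_smul _ _ := rfl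

theorem exists_onePoint_homeomorph {K : Type v} [TopologicalSpace K] [MulAction (Equiv.Perm X) K]
    {b : X → K} (hb : IsGCompactification (Equiv.Perm X) b) :
    ∃ φ : OnePoint X ≃ₜ K, (∀ x : X, φ (x : OnePoint X) = b x) ∧
      ∀ (g : Equiv.Perm X) (p : OnePoint X), φ (g • p) = g • φ p := by
  classical
  have : NoncompactSpace X := noncompactSpace_of_infinite_discrete
  obtain ⟨_, _, _, hemb, hd, hsmul⟩ := hb
  have hopen := isOpen_singleton_of_dense_embedding hemb hd
  have hne : ∃ p, p ∉ range b := by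
    by_contra! h
    have hfin : (range b).Finite := by
      have hdisc : DiscreteTopology K := by
        refine discreteTopology_iff_isOpen_singleton.2 fun y => ?_
        obtain ⟨x, rfl⟩ := h y
        exact hopen x
      exact (isCompact_univ.finite_of_discrete).subset (subset_univ _)
    exact infinite_range_of_injective hemb.injective hfin
  have hmeet : ∀ p ∉ range b, ∀ U ∈ 𝓝 p, ∀ F : Finset X, ∃ x ∉ F, b x ∈ U := by
    intro p hp U hU F
    have hclosed : IsClosed (b '' (F : Set X)) := (F.finite_toSet.image b).isClosed
    have hpF : p ∈ (b '' (F : Set X))ᶜ := fun ⟨x, _, hx⟩ => hp ⟨x, hx⟩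
    obtain ⟨x, hx⟩ := hd.exists_mem_open (isOpen_interior.inter hclosed.isOpen_compl)
      ⟨p, mem_interior_iff_mem_nhds.2 hU, hpF⟩
    exact ⟨x, fun h => hx.2 ⟨x, h, rfl⟩, interior_subset hx.1⟩
  obtain ⟨p, hp⟩ := hne
  have huniq : range b = {p}ᶜ := by
    ext q
    simp only [mem_compl_iff, mem_singleton_iff]
    refine ⟨fun hq h => hp (h ▸ hq), fun hqp => ?_⟩
    by_contra hq
    obtain ⟨V, U, hV, hU, hqV, hpU, hdisj⟩ := t2_separation hqp
    have hcont : ContinuousAt (fun r : Equiv.Perm X × K => r.1 • r.2) (1, p) :=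
      continuous_smul.continuousAt
    have hmem : (fun r : Equiv.Perm X × K => r.1 • r.2) ⁻¹' U ∈ 𝓝 ((1 : Equiv.Perm X), p) :=
      hcont (by simpa using hU.mem_nhds hpU)
    rw [nhds_prod_eq, mem_prod_iff] at hmem
    obtain ⟨S, hS, U', hU', hSU⟩ := hmem
    obtain ⟨F, hF⟩ := exists_finset_of_mem_nhds_one hS
    -- The transposition of `x` and `y` fixes `F`, so it must keep `b x` in `U`; yet it carries `b
    -- x` to `b y`, which lies in `V`.
    obtain ⟨x, hxF, hx⟩ := hmeet p hp U' hU' F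
    obtain ⟨y, hyF, hy⟩ := hmeet q hq V (hV.mem_nhds hqV) F
    have hmem : Equiv.swap x y ∈ S := hF _ fun z hz =>
      Equiv.swap_apply_of_ne_of_ne (fun h => hxF (h ▸ hz)) (fun h => hyF (h ▸ hz))
    have h1 : Equiv.swap x y • b x ∈ U := hSU (mk_mem_prod hmem hx)
    rw [← hsmul] at h1
    have h2 : Equiv.swap x y • x = y := Equiv.swap_apply_left x y
    rw [h2] at h1
    exact disjoint_left.1 hdisj hy h1
  refine ⟨OnePoint.equivOfIsEmbeddingOfRangeEq p b hemb huniq, fun x => rfl, fun g q => ?_⟩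
  have hc : ContinuousConstSMul (Equiv.Perm X) K := inferInstance
  refine congrFun (Continuous.ext_on (OnePoint.denseRange_coe (X := X))
    (f := fun q => OnePoint.equivOfIsEmbeddingOfRangeEq p b hemb huniq (g • q))
    (g := fun q => g • OnePoint.equivOfIsEmbeddingOfRangeEq p b hemb huniq q) ?_ ?_ ?_) q
  · exact (Homeomorph.continuous _).comp (continuous_const_smul g)
  · exact (Homeomorph.continuous _).const_smul g
  · rintro _ ⟨x, rfl⟩
    exact hsmul g x

end OnePoint

/-! ### The elements of `e_{αX} G` -/

theorem exists_pi_subset_of_mem_nhds {ι : Type u} {Y : Type v} [TopologicalSpace Y] {f : ι → Y}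
    {t : Set (ι → Y)} (ht : t ∈ 𝓝 f) :
    ∃ I : Set ι, I.Finite ∧ ∃ V : ι → Set Y, (∀ p, V p ∈ 𝓝 (f p)) ∧ I.pi V ⊆ t := by
  rwa [nhds_pi, Filter.mem_pi] at ht

theorem onePoint_eq_infty_or_coe {X : Type u} (p : OnePoint X) :
    p = OnePoint.infty ∨ ∃ x : X, p = (x : OnePoint X) := by
  induction p using OnePoint.rec <;> simp

section Ellis

variable {X : Type u}

/-- A self-map of `αX` that fixes `∞` and is injective where its value lies in `X`. -/
def IsPartialInjection (f : Function.End (OnePoint X)) : Prop :=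
  f OnePoint.infty = OnePoint.infty ∧
    ∀ x y z : X, f x = (z : OnePoint X) → f y = (z : OnePoint X) → x = y

theorem isPartialInjection_iff (f : Function.End (OnePoint X)) :
    IsPartialInjection f ↔ ∃ Y Z : Set X, BijOn f ((fun x : X => (x : OnePoint X)) '' Y)
          ((fun x : X => (x : OnePoint X)) '' Z) ∧
        ∀ p, p ∉ (fun x : X => (x : OnePoint X)) '' Y → f p = OnePoint.infty := by
  constructor
  · rintro ⟨h0, hinj⟩
    refine ⟨{x | ∃ z : X, f x = (z : OnePoint X)}, {z | ∃ x : X, f x = (z : OnePoint X)},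
      ⟨?_, ?_, ?_⟩, ?_⟩
    · rintro _ ⟨x, ⟨z, hz⟩, rfl⟩
      exact ⟨z, ⟨x, hz⟩, hz.symm⟩
    · rintro _ ⟨x, ⟨z, hz⟩, rfl⟩ _ ⟨y, -, rfl⟩ hxy
      exact congrArg _ (hinj x y z hz (hxy.symm.trans hz))
    · rintro _ ⟨z, ⟨x, hx⟩, rfl⟩
      exact ⟨x, ⟨x, ⟨z, hx⟩, rfl⟩, hx⟩
    · intro p hp
      induction p using OnePoint.rec with
      | infty => exact h0
      | coe x =>
        by_contra hne
        obtain ⟨z, hz⟩ := OnePoint.ne_infty_iff_exists.1 hne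
        exact hp ⟨x, ⟨z, hz.symm⟩, rfl⟩
  · rintro ⟨Y, Z, hb, h0⟩
    refine ⟨h0 _ (by rintro ⟨x, _, hx⟩; exact OnePoint.coe_ne_infty x hx), fun x y z hx hy => ?_⟩
    have key : ∀ x : X, f x = (z : OnePoint X) →
        (x : OnePoint X) ∈ (fun x : X => (x : OnePoint X)) '' Y := by
      intro x hx
      by_contra h
      rw [h0 _ h] at hx
      exact OnePoint.infty_ne_coe z hx
    exact OnePoint.coe_injective (hb.injOn (key x hx) (key y hy) (hx.trans hy.symm))

variable [TopologicalSpace X] [DiscreteTopology X]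

theorem isClosed_setOf_isPartialInjection :
    IsClosed {f : Function.End (OnePoint X) | IsPartialInjection f} := by
  have : {f : Function.End (OnePoint X) | IsPartialInjection f} =
      {f | f OnePoint.infty = OnePoint.infty} ∩
        ⋂ (x : X) (y : X) (z : X) (_ : x ≠ y),
          ({f | f x = (z : OnePoint X)} ∩ {f | f y = (z : OnePoint X)})ᶜ := by
    ext f
    simp only [IsPartialInjection, mem_ofPred_eq, mem_inter_iff, mem_iInter, mem_compl_iff,
      not_and]
    refine and_congr_right fun _ => ⟨fun h x y z hxy hx hy => hxy (h x y z hx hy),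
      fun h x y z hx hy => ?_⟩
    by_contra hxy
    exact h x y z hxy hx hy
  rw [this]
  refine IsClosed.inter ?_ (isClosed_iInter fun x => isClosed_iInter fun y =>
    isClosed_iInter fun z => isClosed_iInter fun _ =>
      ((isClopen_eval_coe _ z).inter (isClopen_eval_coe _ z)).compl.1)
  exact isClosed_singleton.preimage
    (continuous_apply (A := fun _ : OnePoint X => OnePoint X) OnePoint.infty)

/-- A neighbourhood of a point of `αX` contains all but finitely many of the points of `X`, if the
point is `∞`. -/
theorem exists_finset_of_mem_nhds_infty {U : Set (OnePoint X)}
    (hU : U ∈ 𝓝 (OnePoint.infty : OnePoint X)) :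
    ∃ C : Finset X, ∀ x ∉ C, (x : OnePoint X) ∈ U := by
  obtain ⟨s, ⟨-, hs⟩, hsU⟩ := OnePoint.hasBasis_nhds_infty.mem_iff.1 hU
  have hfin : s.Finite := hs.finite_of_discrete
  exact ⟨hfin.toFinset, fun x hx => hsU (Or.inl ⟨x, fun h => hx (hfin.mem_toFinset.2 h), rfl⟩)⟩

variable [Infinite X]

theorem IsPartialInjection.mem_closure {f : Function.End (OnePoint X)}
    (hf : IsPartialInjection f) :
    f ∈ closure (range fun g : Equiv.Perm X =>
      (MulAction.toEndHom g : Function.End (OnePoint X))) := by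
  classical
  rw [mem_closure_iff_nhds]
  intro t ht
  obtain ⟨I, hI, V, hV, hVt⟩ := exists_pi_subset_of_mem_nhds (f := (f : OnePoint X → OnePoint X)) ht
  have hC : ∀ p : OnePoint X, ∃ C : Finset X, f p = OnePoint.infty →
      ∀ x ∉ C, (x : OnePoint X) ∈ V p := by
    intro p
    by_cases hp : f p = OnePoint.infty
    · obtain ⟨C, hC⟩ := exists_finset_of_mem_nhds_infty (hp ▸ hV p)
      exact ⟨C, fun _ => hC⟩
    · exact ⟨∅, fun h => absurd h hp⟩
  choose C hC using hC
  -- `A` holds the coordinates in `X` to be matched, `D` the points that the prescribed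
  -- neighbourhoods of `∞` may omit, and `B` the values in `X` that `f` takes on `A`. Substitutes
  -- for the value `∞` avoid `D` to be close to `∞`, and `B` to preserve injectivity.
  let A : Finset X := (hI.preimage (OnePoint.coe_injective.injOn)).toFinset
  let D : Finset X := hI.toFinset.biUnion C
  let B : Finset X := (A.image fun x : X => f x).preimage (fun x : X => (x : OnePoint X))
    OnePoint.coe_injective.injOn
  have hB : ∀ x ∈ A, ∀ z : X, f x = (z : OnePoint X) → z ∈ B := fun x hx z hz =>
    Finset.mem_preimage.2 (Finset.mem_image.2 ⟨x, hx, hz⟩)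
  obtain ⟨e, heinj, he⟩ : ∃ e : X → X, InjOn e A ∧ ∀ x, e x ∉ D ∪ B := by
    have : Infinite {x // x ∈ ((D ∪ B : Finset X) : Set X)ᶜ} :=
      (Finset.finite_toSet _).infinite_compl.to_subtype
    obtain ⟨n, hn⟩ := nonempty_embedding_nat A
    refine ⟨fun x => Infinite.natEmbedding {x // x ∈ ((D ∪ B : Finset X) : Set X)ᶜ}
      (if h : x ∈ A then n ⟨x, h⟩ else 0), fun x hx y hy hxy => ?_, fun x => ?_⟩
    · have h := (Infinite.natEmbedding _).injective (Subtype.ext hxy)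
      rw [dif_pos (show x ∈ A from hx), dif_pos (show y ∈ A from hy)] at h
      exact congrArg Subtype.val (hn h)
    · exact fun h => (Infinite.natEmbedding {x // x ∈ ((D ∪ B : Finset X) : Set X)ᶜ} _).2 h
  let v : X → X := fun x => (f x).elim (e x) id
  have hv1 : ∀ x z : X, f x = (z : OnePoint X) → v x = z := fun x z h => by simp [v, h]
  have hv2 : ∀ x : X, f x = OnePoint.infty → v x = e x := fun x h => by simp [v, h]
  have hv : InjOn v A := by
    intro x hx y hy hxy
    rcases onePoint_eq_infty_or_coe (f x) with h | ⟨z, hz⟩ <;>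
      rcases onePoint_eq_infty_or_coe (f y) with h' | ⟨w, hw⟩
    · rw [hv2 x h, hv2 y h'] at hxy
      exact heinj hx hy hxy
    · rw [hv2 x h, hv1 y w hw] at hxy
      exact absurd (Finset.mem_union_right D (hxy ▸ hB y hy w hw)) (he x)
    · rw [hv1 x z hz, hv2 y h'] at hxy
      exact absurd (Finset.mem_union_right D (hxy ▸ hB x hx z hz)) (he y)
    · rw [hv1 x z hz, hv1 y w hw] at hxy
      exact hf.2 x y z hz (hxy ▸ hw)
  obtain ⟨g, hg⟩ := exists_perm_eqOn A hv
  refine ⟨MulAction.toEndHom g, hVt fun p hp => ?_, g, rfl⟩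
  change g • p ∈ V p
  induction p using OnePoint.rec with
  | infty =>
    have := mem_of_mem_nhds (hV OnePoint.infty)
    rwa [hf.1] at this
  | coe x =>
    have hx : x ∈ A := by simpa [A] using hp
    rw [perm_smul_coe, hg x hx]
    rcases onePoint_eq_infty_or_coe (f x) with h | ⟨z, hz⟩
    · rw [hv2 x h]
      refine hC _ h _ fun hmem => he x (Finset.mem_union_left B ?_)
      exact Finset.mem_biUnion.2 ⟨x, hI.mem_toFinset.2 hp, hmem⟩
    · rw [hv1 x z hz, ← hz]
      exact mem_of_mem_nhds (hV x)

theorem mem_ellisCompactification_iff (f : Function.End (OnePoint X)) :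
    f ∈ EllisCompactification (Equiv.Perm X) (OnePoint X) ↔ IsPartialInjection f := by
  refine ⟨fun h => ?_, fun h => h.mem_closure⟩
  refine closure_minimal ?_ isClosed_setOf_isPartialInjection h
  rintro _ ⟨g, rfl⟩
  refine ⟨rfl, fun x y z hx hy => ?_⟩
  exact g.injective (OnePoint.coe_injective (hx.trans hy.symm))

end Ellis

/-! ### The symmetric inverse semigroup -/

namespace SymmetricInverseSemigroup

variable {X : Type u}

theorem mul_apply_eq_some_iff (p q : SymmetricInverseSemigroup X) (x z : X) :
    (show X ≃. X from p * q) x = some z ↔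
      ∃ y, (show X ≃. X from q) x = some y ∧ (show X ≃. X from p) y = some z :=
  PEquiv.mem_trans (f := (show X ≃. X from q)) (g := (show X ≃. X from p)) x z

/-- The inverse of a bijection between subsets of `X`. -/
def symm (p : SymmetricInverseSemigroup X) : SymmetricInverseSemigroup X :=
  PEquiv.symm (α := X) (β := X) p

theorem symm_apply_eq_some_iff (p : SymmetricInverseSemigroup X) (x y : X) :
    (show X ≃. X from p.symm) y = some x ↔ (show X ≃. X from p) x = some y :=
  PEquiv.eq_some_iff (show X ≃. X from p)

theorem ext_some {p q : SymmetricInverseSemigroup X}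
    (h : ∀ x y, (show X ≃. X from p) x = some y ↔ (show X ≃. X from q) x = some y) : p = q :=
  PEquiv.ext (f := (show X ≃. X from p)) (g := (show X ≃. X from q)) fun x =>
    Option.ext fun y => h x y

theorem apply_inj (p : SymmetricInverseSemigroup X) {x y z : X}
    (hx : (show X ≃. X from p) x = some z) (hy : (show X ≃. X from p) y = some z) : x = y :=
  PEquiv.inj (show X ≃. X from p) hx hy

theorem mul_symm_mul (p : SymmetricInverseSemigroup X) : p * p.symm * p = p := by
  refine ext_some fun x z => ?_
  simp only [mul_apply_eq_some_iff, symm_apply_eq_some_iff]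
  constructor
  · rintro ⟨y, hy, w, hw, hz⟩
    rwa [p.apply_inj hy hw]
  · exact fun h => ⟨z, h, x, h, h⟩

theorem symm_symm (p : SymmetricInverseSemigroup X) : p.symm.symm = p :=
  PEquiv.symm_symm (show X ≃. X from p)

/-- Evaluating `p * q * p` at `x` shows that `q` is defined at `y` and that `p` sends `q y` back to
`y`; injectivity of `p` gives `q y = x`. Used in both directions, this yields uniqueness of
inverses. -/
theorem apply_eq_some_of_mul_mul_eq {p q : SymmetricInverseSemigroup X} (h : p * q * p = p)
    {x y : X} (hx : (show X ≃. X from p) x = some y) : (show X ≃. X from q) y = some x := by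
  have hx' := hx
  rw [← h] at hx'
  simp only [mul_apply_eq_some_iff] at hx'
  obtain ⟨y', hy', w, hw, hz⟩ := hx'
  obtain rfl : y = y' := Option.some.inj (hx.symm.trans hy')
  rwa [p.apply_inj hx hz]

theorem isInverse_iff (p q : SymmetricInverseSemigroup X) :
    (p * q * p = p ∧ q * p * q = q) ↔ q = p.symm := by
  constructor
  · rintro ⟨h1, h2⟩
    refine ext_some fun y x => ?_
    rw [symm_apply_eq_some_iff]
    exact ⟨apply_eq_some_of_mul_mul_eq h2, apply_eq_some_of_mul_mul_eq h1⟩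
  · rintro rfl
    refine ⟨p.mul_symm_mul, ?_⟩
    have := p.symm.mul_symm_mul
    rwa [symm_symm] at this

/-- A bijection between subsets of `X`, extended to `αX` by the value `∞`. -/
def toEnd (p : SymmetricInverseSemigroup X) : Function.End (OnePoint X) := fun q =>
  q.elim OnePoint.infty fun x => (show X ≃. X from p) x

/-- `OnePoint X` unfolds to `Option X`, with `∞` as `none`, so partial values are already points of
`αX`. -/
theorem toEnd_coe_eq_coe_iff (p : SymmetricInverseSemigroup X) (x y : X) :
    p.toEnd (x : OnePoint X) = (y : OnePoint X) ↔ (show X ≃. X from p) x = some y :=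
  Iff.rfl

theorem isPartialInjection_toEnd (p : SymmetricInverseSemigroup X) :
    IsPartialInjection p.toEnd :=
  ⟨rfl, fun _ _ _ hx hy => p.apply_inj hx hy⟩

theorem toEnd_mul (p q : SymmetricInverseSemigroup X) :
    (p * q).toEnd = p.toEnd * q.toEnd := by
  funext r
  induction r using OnePoint.rec with
  | infty => rfl
  | coe x =>
    change PEquiv.trans (α := X) (β := X) (γ := X) q p x =
      ((show X ≃. X from q) x : OnePoint X).elim OnePoint.infty fun y => (show X ≃. X from p) y
    change ((show X ≃. X from q) x).bind (show X ≃. X from p) = _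
    cases (show X ≃. X from q) x <;> rfl

theorem toEnd_injective : Function.Injective (toEnd (X := X)) := fun p q h =>
  ext_some fun x y => by
    rw [← toEnd_coe_eq_coe_iff, ← toEnd_coe_eq_coe_iff, h]

theorem exists_toEnd_eq {f : Function.End (OnePoint X)} (hf : IsPartialInjection f) :
    ∃ p : SymmetricInverseSemigroup X, p.toEnd = f := by
  classical
  let p : X ≃. X :=
    { toFun := fun x => f (x : OnePoint X)
      invFun := fun z => if h : ∃ x : X, f x = (z : OnePoint X) then some h.choose else none
      inv := by
        intro x z
        change (_ = some x) ↔ f (x : OnePoint X) = (z : OnePoint X)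
        split_ifs with h
        · rw [Option.some.injEq]
          exact ⟨fun hx => hx ▸ h.choose_spec, fun hx => hf.2 _ _ z h.choose_spec hx⟩
        · exact ⟨nofun, fun hx => absurd ⟨x, hx⟩ h⟩ }
  refine ⟨p, funext fun r => ?_⟩
  induction r using OnePoint.rec with
  | infty => exact hf.1.symm
  | coe x => rfl

end SymmetricInverseSemigroup

/-! ### `e_{αX} G` as a semigroup compactification -/

section Ellis

variable {X : Type u} [TopologicalSpace X] [DiscreteTopology X]

local notation "Ell" => EllisCompactification (Equiv.Perm X) (OnePoint X)

theorem continuous_ellis_eval (p : OnePoint X) : Continuous fun f : Ell => f.1 p :=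
  (continuous_apply (A := fun _ : OnePoint X => OnePoint X) p).comp continuous_subtype_val

theorem denseRange_ellisMap : DenseRange (ellisMap (Equiv.Perm X) (OnePoint X)) := by
  intro f
  rw [closure_subtype, ← range_comp]
  exact f.2

instance ellis_compactSpace : CompactSpace Ell :=
  isCompact_iff_compactSpace.1 (isClosed_closure.isCompact (X := OnePoint X → OnePoint X))

instance ellis_t2Space : T2Space Ell :=
  have : T2Space (Function.End (OnePoint X)) :=
    inferInstanceAs (T2Space (OnePoint X → OnePoint X))
  inferInstanceAs (T2Space {f // f ∈ EllisCompactification (Equiv.Perm X) (OnePoint X)})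

variable [Infinite X]

/-- `e_{αX} G` is the symmetric inverse semigroup. -/
noncomputable def symmetricInverseEquivEllis :
    SymmetricInverseSemigroup X ≃* EllisCompactification (Equiv.Perm X) (OnePoint X) :=
  MulEquiv.ofBijective
    (⟨fun p => ⟨p.toEnd, (mem_ellisCompactification_iff _).2 p.isPartialInjection_toEnd⟩,
      fun p q => Subtype.ext (p.toEnd_mul q)⟩ : SymmetricInverseSemigroup X →ₙ*
        EllisCompactification (Equiv.Perm X) (OnePoint X))
    ⟨fun _ _ h => SymmetricInverseSemigroup.toEnd_injective (congrArg Subtype.val h), fun f => by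
      obtain ⟨p, hp⟩ := SymmetricInverseSemigroup.exists_toEnd_eq
        ((mem_ellisCompactification_iff _).1 f.2)
      exact ⟨p, Subtype.ext hp⟩⟩

theorem coe_symmetricInverseEquivEllis (p : SymmetricInverseSemigroup X) :
    (symmetricInverseEquivEllis p : Function.End (OnePoint X)) = p.toEnd := rfl

theorem ellis_apply_infty (f : Ell) : f.1 OnePoint.infty = OnePoint.infty :=
  ((mem_ellisCompactification_iff _).1 f.2).1

theorem continuous_ellis_rng {Y : Type v} [TopologicalSpace Y] {F : Y → Ell}
    (h : ∀ x : X, Continuous fun y => (F y).1 (x : OnePoint X)) : Continuous F := by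
  refine Continuous.subtype_mk (continuous_pi fun p => ?_) _
  induction p using OnePoint.rec with
  | infty => simpa only [ellis_apply_infty] using continuous_const
  | coe x => exact h x

/-- Restricting a self-map to `X` recovers pointwise convergence on `X`, and `X` embeds in `αX`. -/
theorem isEmbedding_ellisMap : IsEmbedding (ellisMap (Equiv.Perm X) (OnePoint X)) where
  injective g h hgh := Equiv.ext fun x => by
    have := congrFun (congrArg Subtype.val hgh) (x : OnePoint X)
    exact OnePoint.coe_injective this
  toIsInducing := by
    have h1 : IsInducing fun (g : Equiv.Perm X) (x : X) => g • x := ⟨rfl⟩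
    have h2 : IsInducing (Pi.map fun (_ : X) (x : X) => (x : OnePoint X)) :=
      IsInducing.piMap fun _ => OnePoint.isOpenEmbedding_coe.isInducing
    refine IsInducing.of_comp (g := fun (f : Ell) (x : X) => f.1 (x : OnePoint X)) ?_ ?_
      (h2.comp h1)
    · exact continuous_ellis_rng fun x => OnePoint.continuous_coe.comp (perm_continuous_apply x)
    · exact continuous_pi fun x => continuous_ellis_eval (x : OnePoint X)

/-- The fibre over a point of `X` is empty or one isolated point. This continuity makes left
multiplications continuous. -/
theorem ellis_apply_continuous (f : Ell) : Continuous f.1 := by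
  refine continuous_onePoint_of_isClopen fun z => ?_
  obtain ⟨h0, hinj⟩ := (mem_ellisCompactification_iff _).1 f.2
  by_cases h : ∃ x : X, f.1 x = (z : OnePoint X)
  · obtain ⟨x, hx⟩ := h
    have : f.1 ⁻¹' {(z : OnePoint X)} = {(x : OnePoint X)} := by
      ext p
      change f.1 p = z ↔ p = x
      induction p using OnePoint.rec with
      | infty => simp [h0]
      | coe y => exact ⟨fun hy => congrArg _ (hinj _ _ z hy hx), fun hy => hy ▸ hx⟩
    rw [this]
    exact isClopen_singleton_coe x
  · have : f.1 ⁻¹' {(z : OnePoint X)} = ∅ := by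
      refine eq_empty_of_forall_notMem fun p => ?_
      change ¬ f.1 p = z
      induction p using OnePoint.rec with
      | infty => simp [h0]
      | coe y => exact fun hy => h ⟨y, hy⟩
    rw [this]
    exact isClopen_empty

theorem isSimCompactification_ellisMap :
    IsSimCompactification (ellisMap (Equiv.Perm X) (OnePoint X)) where
  isGCompactification := by
    let act : MulAction (Equiv.Perm X) Ell :=
      { smul := fun g f => ellisMap _ _ g * f
        one_smul := fun f => Subtype.ext (funext fun p => one_smul (Equiv.Perm X) (f.1 p))
        mul_smul := fun g h f => Subtype.ext (funext fun p => mul_smul g h (f.1 p)) }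
    refine ⟨act, ⟨inferInstance, inferInstance, ⟨?_⟩, isEmbedding_ellisMap, denseRange_ellisMap,
      fun g h => Subtype.ext (funext fun p => mul_smul g h p)⟩, fun g f => rfl⟩
    refine continuous_ellis_rng fun x => ?_
    exact continuous_fst.smul ((continuous_ellis_eval (x : OnePoint X)).comp continuous_snd)
  continuous_mul_right f := continuous_ellis_rng fun x => continuous_ellis_eval _
  continuous_mul_left f := continuous_ellis_rng fun x =>
    (ellis_apply_continuous f).comp (continuous_ellis_eval _)
  exists_inv := by
    let e := symmetricInverseEquivEllis (X := X)
    refine ⟨fun f => e (e.symm f).symm, continuous_ellis_rng fun y =>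
      continuous_onePoint_of_isClopen fun x => ?_, fun f h => ?_⟩
    · have : (fun f : Ell => (e (e.symm f).symm).1 (y : OnePoint X)) ⁻¹' {(x : OnePoint X)} =
          (fun f : Ell => f.1 (x : OnePoint X)) ⁻¹' {(y : OnePoint X)} := by
        ext f
        obtain ⟨p, rfl⟩ := e.surjective f
        simp only [mem_preimage, mem_singleton_iff, e, MulEquiv.symm_apply_apply,
          coe_symmetricInverseEquivEllis, SymmetricInverseSemigroup.toEnd_coe_eq_coe_iff,
          SymmetricInverseSemigroup.symm_apply_eq_some_iff]
      rw [this]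
      exact (isClopen_singleton_coe y).preimage (continuous_ellis_eval (x : OnePoint X))
    · rw [← e.symm_apply_eq, ← SymmetricInverseSemigroup.isInverse_iff, ← map_mul, ← map_mul,
        ← map_mul, ← map_mul, e.symm.injective.eq_iff, e.symm.injective.eq_iff]

end Ellis

/-! ### The Roelcke uniformity of `S(X)` -/

/-- A dense uniformly inducing map into a complete Hausdorff space is a completion. -/
theorem exists_homeomorph_completion {α : Type u} [UniformSpace α] {S : Type v} [UniformSpace S]
    [CompleteSpace S] [T0Space S] {i : α → S} (hi : IsUniformInducing i) (hd : DenseRange i) :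
    ∃ φ : S ≃ₜ UniformSpace.Completion α, ∀ a, φ (i a) = a := by
  let pkg : AbstractCompletion α := ⟨S, i, inferInstance, inferInstance, inferInstance, hi, hd⟩
  let e : S ≃ᵤ UniformSpace.Completion α := pkg.compareEquiv UniformSpace.Completion.cPkg
  exact ⟨e.toHomeomorph, fun a => pkg.compare_coe UniformSpace.Completion.cPkg a⟩

theorem precompactReplica_eq_self {α : Type u} {𝒰 : UniformSpace α}
    (h : @TotallyBounded α 𝒰 univ) : precompactReplica 𝒰 = 𝒰 :=
  le_antisymm (sInf_le ⟨le_rfl, h⟩) (le_sInf fun _ h => h.1)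

section Roelcke

variable {X : Type u} [TopologicalSpace X] [DiscreteTopology X]

local notation "Ell" => EllisCompactification (Equiv.Perm X) (OnePoint X)

/-- The uniformity of pointwise convergence on `S(X)`, acting on the compact space `αX`. -/
@[reducible] def permOnePointUniformSpace (X : Type u) [TopologicalSpace X] [DiscreteTopology X] :
    UniformSpace (Equiv.Perm X) :=
  ⨅ p : OnePoint X, UniformSpace.comap (fun g : Equiv.Perm X => g • p) uniformSpaceOfCompactR1

theorem perm_stabilizer_mem_nhds_one (F : Finset X) :
    {g : Equiv.Perm X | ∀ x ∈ F, g x = x} ∈ 𝓝 (1 : Equiv.Perm X) := by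
  have : ∀ᶠ g in 𝓝 (1 : Equiv.Perm X), ∀ x ∈ F, g x = x :=
    (Filter.eventually_all_finset F).2 fun x _ => (perm_isClopen_apply_eq x x).2.mem_nhds rfl
  exact this

/-- Away from a finite set all points are close to `∞`, hence to each other. -/
theorem exists_finset_of_mem_nhdsSet_diagonal {V : Set (OnePoint X × OnePoint X)}
    (hV : V ∈ 𝓝ˢ (diagonal (OnePoint X))) :
    ∃ F : Finset X, ∀ p q : OnePoint X, (∀ x ∈ F, p ≠ (x : OnePoint X)) →
      (∀ x ∈ F, q ≠ (x : OnePoint X)) → (p, q) ∈ V := by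
  have h := mem_nhdsSet_iff_forall.1 hV (OnePoint.infty, OnePoint.infty) rfl
  rw [nhds_prod_eq, mem_prod_self_iff] at h
  obtain ⟨U, hU, hUV⟩ := h
  obtain ⟨F, hF⟩ := exists_finset_of_mem_nhds_infty hU
  have key : ∀ p : OnePoint X, (∀ x ∈ F, p ≠ (x : OnePoint X)) → p ∈ U := by
    intro p hp
    rcases onePoint_eq_infty_or_coe p with rfl | ⟨x, rfl⟩
    · exact mem_of_mem_nhds hU
    · exact hF x fun h => hp x h rfl
  exact ⟨F, fun p q hp hq => hUV ⟨key p hp, key q hq⟩⟩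

theorem roelckeUniformSpace_le :
    roelckeUniformSpace (Equiv.Perm X) ≤ permOnePointUniformSpace X := by
  refine le_iInf fun p => sup_le ?_ ?_
  · rintro _ ⟨V, hV, hVt⟩
    have hdiag : ∀ r : OnePoint X, (r, r) ∈ V := fun r => subset_of_mem_nhdsSet hV rfl
    rcases onePoint_eq_infty_or_coe p with rfl | ⟨x, rfl⟩
    · exact mem_of_superset univ_mem fun q _ => hVt (hdiag _)
    · refine ⟨_, perm_stabilizer_mem_nhds_one {x}, fun q hq => hVt ?_⟩
      have hx : q.2 x = q.1 x :=
        Equiv.Perm.inv_eq_iff_eq.1 (hq x (Finset.mem_singleton_self x)) |>.trans rfl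
      change (((q.1 x : X) : OnePoint X), ((q.2 x : X) : OnePoint X)) ∈ V
      rw [hx]
      exact hdiag _
  · rintro _ ⟨V, hV, hVt⟩
    obtain ⟨F, hF⟩ := exists_finset_of_mem_nhdsSet_diagonal hV
    refine ⟨_, perm_stabilizer_mem_nhds_one F, fun q hq => hVt ?_⟩
    change (q.1 • p, q.2 • p) ∈ V
    have hq2 : q.2 • p = (q.2 * q.1⁻¹) • (q.1 • p) := by
      rw [smul_smul, inv_mul_cancel_right]
    rw [hq2]
    -- The permutation `q.2 * q.1⁻¹` fixes `F` pointwise. If `q.1 • p` lies in `F`, the two images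
    -- coincide; otherwise both lie outside `F`.
    by_cases h : ∃ x ∈ F, q.1 • p = (x : OnePoint X)
    · obtain ⟨x, hx, hpx⟩ := h
      rw [hpx, perm_smul_coe, hq x hx]
      exact subset_of_mem_nhdsSet hV rfl
    · push Not at h
      refine hF _ _ h fun x hx hpx => h x hx ?_
      rwa [perm_smul_eq_coe_iff, Equiv.Perm.inv_eq_iff_eq.2 (hq x hx).symm] at hpx

/-- The double coset of `g` with respect to the pointwise stabilizer of `F` is determined by the
restriction of `g` to a partial map from `F` to `F`. -/
theorem exists_stabilizer_mul_eq {X : Type u} (F : Finset X) (g h : Equiv.Perm X)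
    (hgh : ∀ a ∈ F, ∀ b ∈ F, g a = b ↔ h a = b) :
    ∃ k : Equiv.Perm X, (∀ a ∈ F, (g⁻¹ * k) a = a) ∧ ∀ b ∈ F, (h * k⁻¹) b = b := by
  classical
  -- The permutation `k` has to agree with `g` on `F` and with `h` on `h⁻¹ F`. The hypothesis makes
  -- these demands compatible on the overlap and rules out collisions.
  obtain ⟨k, hk⟩ := exists_perm_eqOn (F ∪ F.image (h⁻¹ : Equiv.Perm X))
    (f := fun x => if x ∈ F then g x else h x) (by
      have key : ∀ x y : X, x ∈ F → y ∉ F →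
          y ∈ F ∪ F.image (h⁻¹ : Equiv.Perm X) → g x ≠ h y := by
        intro x y hx hy hyF hxy
        obtain ⟨b, hb, rfl⟩ := Finset.mem_image.1 ((Finset.mem_union.1 hyF).resolve_left hy)
        have hxb : h x = b := (hgh x hx b hb).1 (hxy.trans (by simp))
        exact hy (by simpa [← hxb] using hx)
      intro x hx y hy hxy
      dsimp only at hxy
      split_ifs at hxy with h1 h2 h2
      · exact g.injective hxy
      · exact absurd hxy (key x y h1 h2 hy)
      · exact absurd hxy.symm (key y x h2 h1 hx)
      · exact h.injective hxy)
  refine ⟨k, fun a ha => ?_, fun b hb => ?_⟩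
  · rw [Equiv.Perm.mul_apply, hk a (Finset.mem_union_left _ ha), if_pos ha]
    simp
  · have hkb : k (h⁻¹ b) = b := by
      rw [hk _ (Finset.mem_union_right _ (Finset.mem_image_of_mem _ hb))]
      split_ifs with hF
      · exact (hgh _ hF b hb).2 (by simp)
      · simp
    rw [Equiv.Perm.mul_apply, Equiv.Perm.inv_eq_iff_eq.2 hkb.symm]
    simp

theorem le_roelckeUniformSpace :
    permOnePointUniformSpace X ≤ roelckeUniformSpace (Equiv.Perm X) := by
  classical
  intro V hV
  obtain ⟨W, hW, hWV⟩ := @comp_mem_uniformity_sets _ (roelckeUniformSpace (Equiv.Perm X)) V hV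
  have hl : W ∈ @uniformity _ (IsTopologicalGroup.leftUniformSpace (Equiv.Perm X)) :=
    (le_sup_left : _ ≤ roelckeUniformSpace (Equiv.Perm X)) hW
  have hr : W ∈ @uniformity _ (IsTopologicalGroup.rightUniformSpace (Equiv.Perm X)) :=
    (le_sup_right : _ ≤ roelckeUniformSpace (Equiv.Perm X)) hW
  obtain ⟨S, hS, hSW⟩ := hl
  obtain ⟨S', hS', hSW'⟩ := hr
  obtain ⟨F, hF⟩ := exists_finset_of_mem_nhds_one (inter_mem hS hS')
  have hmem : ∀ a ∈ F, ∀ b ∈ F, {q : Equiv.Perm X × Equiv.Perm X | q.1 a = b ↔ q.2 a = b} ∈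
      @uniformity _ (permOnePointUniformSpace X) := by
    intro a _ b _
    have hV : {r : OnePoint X × OnePoint X | r.1 = b ↔ r.2 = b} ∈ 𝓝ˢ (diagonal (OnePoint X)) := by
      have hb := (isClopen_singleton_coe b).preimage (continuous_fst (X := OnePoint X)
        (Y := OnePoint X))
      have hb' := (isClopen_singleton_coe b).preimage (continuous_snd (X := OnePoint X)
        (Y := OnePoint X))
      have heq : {r : OnePoint X × OnePoint X | r.1 = b ↔ r.2 = b} =
          (Prod.fst ⁻¹' {(b : OnePoint X)} ∩ Prod.snd ⁻¹' {(b : OnePoint X)}) ∪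
          ((Prod.fst ⁻¹' {(b : OnePoint X)})ᶜ ∩ (Prod.snd ⁻¹' {(b : OnePoint X)})ᶜ) := by
        ext r
        exact iff_iff_and_or_not_and_not
      refine IsOpen.mem_nhdsSet ?_ |>.2 ?_
      · rw [heq]
        exact (hb.2.inter hb'.2).union (hb.1.isOpen_compl.inter hb'.1.isOpen_compl)
      · rintro ⟨r, r'⟩ (rfl : r = r')
        exact Iff.rfl
    refine (iInf_le _ (a : OnePoint X) : permOnePointUniformSpace X ≤ _) ⟨_, hV, ?_⟩
    rintro ⟨g, h⟩ hgh
    exact (OnePoint.coe_eq_coe.symm.trans hgh).trans OnePoint.coe_eq_coe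
  have := (Filter.biInter_finset_mem F).2 fun a ha => (Filter.biInter_finset_mem F).2 (hmem a ha)
  refine mem_of_superset this ?_
  rintro ⟨g, h⟩ hgh
  simp only [mem_iInter] at hgh
  obtain ⟨k, hk, hk'⟩ := exists_stabilizer_mul_eq F g h hgh
  -- The intermediate `k` is left-close to `g` and right-close to `h`.
  exact hWV ⟨k, hSW (hF _ hk).1, hSW' (hF _ hk').2⟩

theorem roelckeUniformSpace_perm :
    roelckeUniformSpace (Equiv.Perm X) = permOnePointUniformSpace X :=
  le_antisymm roelckeUniformSpace_le le_roelckeUniformSpace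

/-- The uniformity of pointwise convergence on `e_{αX} G`. -/
@[reducible] def ellisUniformSpace (X : Type u) [TopologicalSpace X] [DiscreteTopology X] :
    UniformSpace (EllisCompactification (Equiv.Perm X) (OnePoint X)) :=
  UniformSpace.comap (fun f (p : OnePoint X) => f.1 p)
    (@Pi.uniformSpace _ (fun _ => OnePoint X) fun _ => uniformSpaceOfCompactR1)

theorem isUniformInducing_ellisMap :
    @IsUniformInducing _ _ (roelckeUniformSpace (Equiv.Perm X)) (ellisUniformSpace X)
      (ellisMap (Equiv.Perm X) (OnePoint X)) := by
  let _ : UniformSpace (OnePoint X) := uniformSpaceOfCompactR1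
  rw [roelckeUniformSpace_perm]
  refine (@isUniformInducing_iff_uniformSpace _ _ (permOnePointUniformSpace X)
    (ellisUniformSpace X) _).2 ?_
  simp only [Pi.uniformSpace_eq, UniformSpace.comap_iInf, ← UniformSpace.comap_comap]
  rfl

/-- Total boundedness is pulled back from the compact closure. -/
theorem isRoelckePrecompact_perm : IsRoelckePrecompact (Equiv.Perm X) :=
  @totallyBounded_preimage _ _ (roelckeUniformSpace (Equiv.Perm X))
    (ellisUniformSpace X) _ univ isUniformInducing_ellisMap
    (@IsCompact.totallyBounded _ (ellisUniformSpace X) _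
      (@isCompact_univ _ (ellisUniformSpace X).toTopologicalSpace ellis_compactSpace))

theorem exists_homeomorph_roelckeCompactification [Infinite X] :
    ∃ φ : Ell ≃ₜ RoelckeCompactification (Equiv.Perm X),
      ∀ g, φ (ellisMap (Equiv.Perm X) (OnePoint X) g) = roelckeMap (Equiv.Perm X) g := by
  let _ : UniformSpace Ell := ellisUniformSpace X
  have hT0 : @T0Space Ell instTopologicalSpaceSubtype := inferInstance
  have hcomplete : CompleteSpace Ell :=
    @complete_of_compact _ (ellisUniformSpace X) ellis_compactSpace
  have hi := isUniformInducing_ellisMap (X := X)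
  rw [← precompactReplica_eq_self (isRoelckePrecompact_perm (X := X))] at hi
  exact @exists_homeomorph_completion _ (precompactReplica (roelckeUniformSpace (Equiv.Perm X)))
    _ _ hcomplete hT0 _ hi denseRange_ellisMap

end Roelcke

/-! ### The WAP-compactification of `S(X)` -/

/-- Double limits exchange in a compact semitopological semigroup. -/
theorem not_disjoint_of_double_limit {T : Type w} [Mul T] [TopologicalSpace T] [CompactSpace T]
    (hl : ∀ s : T, Continuous fun t => s * t) (hr : ∀ t : T, Continuous fun s => s * t)
    {P Q : Set T} (hP : IsClosed P) (hQ : IsClosed Q) {a b : ℕ → T}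
    (h1 : ∀ i j, i < j → a i * b j ∈ P) (h2 : ∀ i j, j ≤ i → a i * b j ∈ Q) : ¬ Disjoint P Q := by
  have hlim : ∀ a : ℕ → T, ∃ s, Tendsto a (hyperfilter ℕ) (𝓝 s) := fun a => by
    -- Sequences in `T` need not have convergent subsequences, so limits are taken along a free
    -- ultrafilter.
    obtain ⟨s, -, hs⟩ := isCompact_univ.ultrafilter_le_nhds ((hyperfilter ℕ).map a) (by simp)
    exact ⟨s, hs⟩
  have hev : ∀ n : ℕ, ∀ᶠ i in (hyperfilter ℕ : Filter ℕ), n < i := fun n =>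
    Nat.hyperfilter_le_atTop (eventually_gt_atTop n)
  obtain ⟨s, hs⟩ := hlim a
  obtain ⟨t, ht⟩ := hlim b
  have hPmem : s * t ∈ P := by
    refine hP.mem_of_tendsto (((hr t).tendsto s).comp hs) (Eventually.of_forall fun i => ?_)
    exact hP.mem_of_tendsto (((hl (a i)).tendsto t).comp ht) ((hev i).mono fun j => h1 i j)
  have hQmem : s * t ∈ Q := by
    refine hQ.mem_of_tendsto (((hl s).tendsto t).comp ht) (Eventually.of_forall fun j => ?_)
    exact hQ.mem_of_tendsto (((hr (b j)).tendsto s).comp hs)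
      ((hev j).mono fun i hi => h2 i j hi.le)
  exact fun h => disjoint_left.1 h hPmem hQmem

/-- Swap the `i`-th members of two disjoint families for all `i ≥ j`. -/
theorem exists_perm_swap_tail {X : Type u} {ι : Type v} {x y : ℕ → ι → X}
    (hinj : Function.Injective (Sum.elim (fun p : ℕ × ι => x p.1 p.2)
      (fun p : ℕ × ι => y p.1 p.2))) (j : ℕ) :
    ∃ g : Equiv.Perm X, (∀ i < j, ∀ b, g (x i b) = x i b) ∧ (∀ i ≥ j, ∀ b, g (y i b) = x i b) ∧
      ∀ z, (∀ i b, z ≠ x i b) → (∀ i b, z ≠ y i b) → g z = z := by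
  classical
  -- The swap is an involution of the index set, carried to `X` by the injection `hinj` and extended
  -- by the identity.
  let σ : (ℕ × ι) ⊕ (ℕ × ι) → (ℕ × ι) ⊕ (ℕ × ι) :=
    Sum.elim (fun p => if j ≤ p.1 then Sum.inr p else Sum.inl p)
      (fun p => if j ≤ p.1 then Sum.inl p else Sum.inr p)
  have hσ : Function.Involutive σ := by
    rintro (p | p) <;> by_cases h : j ≤ p.1 <;> simp [σ, h]
  let e : Equiv.Perm ((ℕ × ι) ⊕ (ℕ × ι)) := hσ.toPerm
  refine ⟨e.viaEmbedding ⟨_, hinj⟩, fun i hi b => ?_, fun i hi b => ?_, fun z hx hy => ?_⟩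
  · have h := e.viaEmbedding_apply ⟨_, hinj⟩ (Sum.inl (i, b))
    have he : e (Sum.inl (i, b)) = Sum.inl (i, b) := if_neg (not_le.2 hi)
    rw [he] at h
    exact h
  · have h := e.viaEmbedding_apply ⟨_, hinj⟩ (Sum.inr (i, b))
    have he : e (Sum.inr (i, b)) = Sum.inl (i, b) := if_pos hi
    rw [he] at h
    exact h
  · refine e.viaEmbedding_apply_of_notMem _ _ ?_
    rintro ⟨p | p, hp⟩
    · exact hx _ _ hp.symm
    · exact hy _ _ hp.symm

section

variable {X : Type u} [TopologicalSpace X] [DiscreteTopology X]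

local notation "Ell" => EllisCompactification (Equiv.Perm X) (OnePoint X)

/-- Two sequences of permutations whose inverses agree on `B₀` and move `B₁` to pairwise disjoint
sets. -/
theorem exists_disjoint_sequences {X : Type u} [DecidableEq X] {B₀ B₁ : Finset X} {ρ : X → X}
    {P Q : Set (Equiv.Perm X)}
    (hP : ∀ C : Finset X, ∃ h ∈ P, (∀ b ∈ B₀, h⁻¹ b = ρ b) ∧ ∀ b ∈ B₁, h⁻¹ b ∉ C)
    (hQ : ∀ C : Finset X, ∃ h ∈ Q, (∀ b ∈ B₀, h⁻¹ b = ρ b) ∧ ∀ b ∈ B₁, h⁻¹ b ∉ C) :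
    ∃ h k : ℕ → Equiv.Perm X, (∀ i, h i ∈ P) ∧ (∀ i, k i ∈ Q) ∧
      (∀ i, ∀ b ∈ B₀, (h i)⁻¹ b = ρ b) ∧ (∀ i, ∀ b ∈ B₀, (k i)⁻¹ b = ρ b) ∧
      Function.Injective (Sum.elim (fun p : ℕ × B₁ => (h p.1)⁻¹ (p.2 : X))
        (fun p : ℕ × B₁ => (k p.1)⁻¹ (p.2 : X))) := by
  let D : Equiv.Perm X × Equiv.Perm X → Finset X := fun q =>
    B₁.image (q.1⁻¹ : Equiv.Perm X) ∪ B₁.image (q.2⁻¹ : Equiv.Perm X)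
  have hD1 : ∀ q, ∀ b ∈ B₁, q.1⁻¹ b ∈ D q := fun q b hb =>
    Finset.mem_union_left _ (Finset.mem_image_of_mem _ hb)
  have hD2 : ∀ q, ∀ b ∈ B₁, q.2⁻¹ b ∈ D q := fun q b hb =>
    Finset.mem_union_right _ (Finset.mem_image_of_mem _ hb)
  have hsymm : Std.Symm fun q r => Disjoint (D q) (D r) := ⟨fun _ _ h => h.symm⟩
  -- Pairs are chosen recursively, each moving `B₁` off the finite set used so far, and its second
  -- member off the image under its first.
  obtain ⟨f, hf, hdisj⟩ := exists_seq_of_forall_finset_exists'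
    (fun q : Equiv.Perm X × Equiv.Perm X => q.1 ∈ P ∧ q.2 ∈ Q ∧ (∀ b ∈ B₀, q.1⁻¹ b = ρ b) ∧
      (∀ b ∈ B₀, q.2⁻¹ b = ρ b) ∧ ∀ b ∈ B₁, ∀ c ∈ B₁, q.1⁻¹ b ≠ q.2⁻¹ c)
    (fun q r => Disjoint (D q) (D r)) (fun s _ => by
      obtain ⟨h, hhP, hh0, hh1⟩ := hP (s.biUnion D)
      obtain ⟨k, hkQ, hk0, hk1⟩ := hQ (s.biUnion D ∪ B₁.image (h⁻¹ : Equiv.Perm X))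
      refine ⟨(h, k), ⟨hhP, hkQ, hh0, hk0, fun b hb c hc hbc => hk1 c hc ?_⟩, fun q hq => ?_⟩
      · rw [← hbc]
        exact Finset.mem_union_right _ (Finset.mem_image_of_mem _ hb)
      · rw [Finset.disjoint_left]
        intro x hx hx'
        have hxs : x ∈ s.biUnion D := Finset.mem_biUnion.2 ⟨q, hq, hx⟩
        rcases Finset.mem_union.1 hx' with hx' | hx' <;>
          obtain ⟨b, hb, rfl⟩ := Finset.mem_image.1 hx'
        · exact hh1 b hb hxs
        · exact hk1 b hb (Finset.mem_union_left _ hxs))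
  have hidx : ∀ {i j x}, x ∈ D (f i) → x ∈ D (f j) → i = j := by
    intro i j x hi hj
    by_contra hij
    exact Finset.disjoint_left.1 (hdisj hij) hi hj
  refine ⟨fun i => (f i).1, fun i => (f i).2, fun i => (hf i).1, fun i => (hf i).2.1,
    fun i => (hf i).2.2.1, fun i => (hf i).2.2.2.1, ?_⟩
  rintro (⟨i, b⟩ | ⟨i, b⟩) (⟨j, c⟩ | ⟨j, c⟩) hbc <;> simp only [Sum.elim_inl, Sum.elim_inr] at hbc
  · obtain rfl := hidx (hD1 (f i) b b.2) (hbc ▸ hD1 (f j) c c.2)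
    rw [Subtype.ext ((f i).1⁻¹.injective hbc)]
  · obtain rfl := hidx (hD1 (f i) b b.2) (hbc ▸ hD2 (f j) c c.2)
    exact absurd hbc ((hf i).2.2.2.2 b b.2 c c.2)
  · obtain rfl := hidx (hD2 (f i) b b.2) (hbc ▸ hD1 (f j) c c.2)
    exact absurd hbc.symm ((hf i).2.2.2.2 c c.2 b b.2)
  · obtain rfl := hidx (hD2 (f i) b b.2) (hbc ▸ hD2 (f j) c c.2)
    rw [Subtype.ext ((f i).2⁻¹.injective hbc)]

/-- A jointly continuous action of `S(X)`: near the identity stabilizers of finite sets move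
neighbourhoods of a point only a little. -/
theorem exists_finset_smul_mem {X : Type u} [TopologicalSpace X] {T : Type w} [TopologicalSpace T]
    [MulAction (Equiv.Perm X) T] [ContinuousSMul (Equiv.Perm X) T] {t : T} {U : Set T}
    (hU : U ∈ 𝓝 t) :
    ∃ F : Finset X, ∃ V ∈ 𝓝 t, ∀ g : Equiv.Perm X, (∀ x ∈ F, g x = x) → ∀ s ∈ V, g • s ∈ U := by
  have hcont : ContinuousAt (fun r : Equiv.Perm X × T => r.1 • r.2) (1, t) :=
    continuous_smul.continuousAt
  have hmem : (fun r : Equiv.Perm X × T => r.1 • r.2) ⁻¹' U ∈ 𝓝 ((1 : Equiv.Perm X), t) :=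
    hcont (by simpa using hU)
  rw [nhds_prod_eq, mem_prod_iff] at hmem
  obtain ⟨S, hS, V, hV, hSV⟩ := hmem
  obtain ⟨F, hF⟩ := exists_finset_of_mem_nhds_one hS
  exact ⟨F, V, hV, fun g hg s hs => hSV (mk_mem_prod (hF g hg) hs)⟩

/-- An sm-compactification map of `S(X)` has at most one cluster point along the trace of a
neighbourhood filter of `e_{αX} G`. -/
theorem eq_of_clusterPt_ellis {T : Type w} [Monoid T] [TopologicalSpace T]
    {c : Equiv.Perm X → T} (hc : IsSmCompactification c) (f : Ell) {p q : T}
    (hp : MapClusterPt p (comap (ellisMap (Equiv.Perm X) (OnePoint X)) (𝓝 f)) c)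
    (hq : MapClusterPt q (comap (ellisMap (Equiv.Perm X) (OnePoint X)) (𝓝 f)) c) : p = q := by
  classical
  obtain ⟨act, ⟨_, _, _, -, -, hcsmul⟩, hact⟩ := hc.isGCompactification
  by_contra hpq
  obtain ⟨P, hP, Q, hQ, hPQ⟩ : ∃ P ∈ 𝓝 p, ∃ Q ∈ 𝓝 q, Disjoint (closure P) (closure Q) := by
    obtain ⟨P, hpP, hP, Q, hqQ, hQ, h⟩ := exists_open_nhds_disjoint_closure hpq
    exact ⟨P, hP.mem_nhds hpP, Q, hQ.mem_nhds hqQ, h⟩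
  obtain ⟨F, V, hV, hFV⟩ := exists_finset_smul_mem (X := X) hP
  obtain ⟨F', V', hV', hFV'⟩ := exists_finset_smul_mem (X := X) hQ
  -- Near `f`, the inverse of a permutation is prescribed on `B₀`, the part of `B` in the range of
  -- `f`, while on `B₁` it escapes every finite set.
  let B : Finset X := F ∪ F'
  let B₀ : Finset X := B.filter fun b => ∃ x : X, f.1 x = (b : OnePoint X)
  let B₁ : Finset X := B.filter fun b => ¬ ∃ x : X, f.1 x = (b : OnePoint X)
  obtain ⟨ρ, hρ⟩ : ∃ ρ : X → X, ∀ b ∈ B₀, f.1 (ρ b) = (b : OnePoint X) := by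
    have : ∀ b, ∃ x : X, b ∈ B₀ → f.1 x = (b : OnePoint X) := fun b => by
      by_cases hb : b ∈ B₀
      · obtain ⟨x, hx⟩ := (Finset.mem_filter.1 hb).2
        exact ⟨x, fun _ => hx⟩
      · exact ⟨b, fun h => absurd h hb⟩
    choose ρ hρ using this
    exact ⟨ρ, hρ⟩
  set 𝒩 := comap (ellisMap (Equiv.Perm X) (OnePoint X)) (𝓝 f)
  have hval : ∀ (x z : X), ∀ᶠ g : Equiv.Perm X in 𝒩, (g x = z ↔ f.1 x = (z : OnePoint X)) := by
    intro x z
    have hev : ∀ᶠ f' : Ell in 𝓝 f, (f'.1 x = (z : OnePoint X) ↔ f.1 x = (z : OnePoint X)) := by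
      have hclopen := (isClopen_singleton_coe z).preimage
        (continuous_ellis_eval (X := X) (x : OnePoint X))
      by_cases h : f.1 x = (z : OnePoint X)
      · have hev : ∀ᶠ f' : Ell in 𝓝 f, f'.1 x = (z : OnePoint X) := hclopen.2.mem_nhds h
        exact hev.mono fun f' hf' => iff_of_true hf' h
      · have hev : ∀ᶠ f' : Ell in 𝓝 f, ¬ f'.1 x = (z : OnePoint X) :=
          hclopen.1.isOpen_compl.mem_nhds h
        exact hev.mono fun f' hf' => iff_of_false hf' h
    refine (tendsto_comap.eventually hev).mono fun g hg => ?_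
    exact OnePoint.coe_eq_coe.symm.trans hg
  have hcl : ∀ {r : T} {U : Set T}, U ∈ 𝓝 r → MapClusterPt r 𝒩 c → ∀ C : Finset X,
      ∃ h ∈ c ⁻¹' U, (∀ b ∈ B₀, h⁻¹ b = ρ b) ∧ ∀ b ∈ B₁, h⁻¹ b ∉ C := by
    intro r U hU hr C
    have h0 : ∀ᶠ g : Equiv.Perm X in 𝒩, ∀ b ∈ B₀, g⁻¹ b = ρ b :=
      (Filter.eventually_all_finset B₀).2 fun b hb => (hval (ρ b) b).mono fun g hg =>
        Equiv.Perm.inv_eq_iff_eq.2 (hg.2 (hρ b hb)).symm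
    have h1 : ∀ᶠ g : Equiv.Perm X in 𝒩, ∀ b ∈ B₁, g⁻¹ b ∉ C := by
      have : ∀ᶠ g : Equiv.Perm X in 𝒩, ∀ b ∈ B₁, ∀ x ∈ C, g x ≠ b :=
        (Filter.eventually_all_finset B₁).2 fun b hb => (Filter.eventually_all_finset C).2
          fun x _ => (hval x b).mono fun g hg h => (Finset.mem_filter.1 hb).2 ⟨x, hg.1 h⟩
      exact this.mono fun g hg b hb hx => hg b hb _ hx (by simp)
    obtain ⟨g, hgU, hg0, hg1⟩ := ((hr.frequently hU).and_eventually (h0.and h1)).exists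
    exact ⟨g, hgU, hg0, hg1⟩
  obtain ⟨h, k, hh, hk, hh0, hk0, hinj⟩ :=
    exists_disjoint_sequences (hcl hV hp) (hcl hV' hq)
  choose σ hσ1 hσ2 hσ3 using exists_perm_swap_tail (x := fun i (b : B₁) => (h i)⁻¹ (b : X))
    (y := fun i (b : B₁) => (k i)⁻¹ (b : X)) hinj
  have hmul : ∀ g g', c (g * g') = g • c g' := hcsmul
  have hB : ∀ b ∈ B, b ∈ B₀ ∨ b ∈ B₁ := fun b hb => by
    by_cases h : ∃ x : X, f.1 x = (b : OnePoint X)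
    · exact Or.inl (Finset.mem_filter.2 ⟨hb, h⟩)
    · exact Or.inr (Finset.mem_filter.2 ⟨hb, h⟩)
  -- The point `ρ b` is the image of `b` under every `(h i)⁻¹` and `(k i)⁻¹`; as `b` is not in `B₁`,
  -- it is outside both swapped families.
  have hfix : ∀ j, ∀ b ∈ B₀, σ j (ρ b) = ρ b := by
    intro j b hb
    have hne : ∀ b' : B₁, b ≠ b' := fun b' hbb => by
      have hb' := (Finset.mem_filter.1 b'.2).2
      rw [← hbb] at hb'
      exact hb' (Finset.mem_filter.1 hb).2
    refine hσ3 j _ (fun i b' hb' => ?_) fun i b' hb' => ?_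
    · rw [← hh0 i b hb] at hb'
      exact hne b' ((h i)⁻¹.injective hb')
    · rw [← hk0 i b hb] at hb'
      exact hne b' ((k i)⁻¹.injective hb')
  have hcmul : ∀ i j, c (h i) * c (σ j) = c (h i * σ j) := fun i j => by
    rw [hmul, hact]
  refine not_disjoint_of_double_limit (a := fun i => c (h i)) (b := fun j => c (σ j))
    hc.continuous_mul_left hc.continuous_mul_right isClosed_closure isClosed_closure
    (fun i j hij => subset_closure ?_) (fun i j hij => subset_closure ?_) hPQ
  -- For `i < j` the bracketed factor fixes `B`, so `c (h i * σ j)` stays near `c (h i)`, in `P`.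
  · rw [hcmul, show h i * σ j = (h i * σ j * (h i)⁻¹) * h i by group, hmul]
    refine hFV _ (fun b hb => ?_) _ (hh i)
    change h i (σ j ((h i)⁻¹ b)) = b
    rw [← Equiv.Perm.eq_inv_iff_eq]
    rcases hB b (Finset.mem_union_left _ hb) with hb | hb
    · rw [hh0 i b hb, hfix j b hb]
    · exact hσ1 j i hij ⟨b, hb⟩
  -- For `j ≤ i`, `σ j` carries `(k i)⁻¹ b` to `(h i)⁻¹ b` on `B₁`, so the same product is near `c
  -- (k i)`, in `Q`.
  · rw [hcmul, show h i * σ j = (h i * σ j * (k i)⁻¹) * k i by group, hmul]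
    refine hFV' _ (fun b hb => ?_) _ (hk i)
    change h i (σ j ((k i)⁻¹ b)) = b
    rw [← Equiv.Perm.eq_inv_iff_eq]
    rcases hB b (Finset.mem_union_right _ hb) with hb | hb
    · rw [hh0 i b hb, hk0 i b hb, hfix j b hb]
    · exact hσ2 j i hij ⟨b, hb⟩

theorem compactificationLE_ellisMap [Infinite X] {T : Type w} [Monoid T] [TopologicalSpace T]
    {c : Equiv.Perm X → T} (hc : IsSmCompactification c) :
    CompactificationLE c (ellisMap (Equiv.Perm X) (OnePoint X)) := by
  obtain ⟨act, ⟨_, _, _, hemb, -, -⟩, -⟩ := hc.isGCompactification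
  have hd : IsDenseInducing (ellisMap (Equiv.Perm X) (OnePoint X)) :=
    ⟨isEmbedding_ellisMap.isInducing, denseRange_ellisMap⟩
  refine ⟨hd.extend c, hd.continuous_extend fun f => ?_, funext fun g =>
    hd.extend_eq hemb.continuous g⟩
  have hne : (comap (ellisMap (Equiv.Perm X) (OnePoint X)) (𝓝 f)).NeBot := hd.comap_nhds_neBot f
  obtain ⟨p, -, hp⟩ := isCompact_univ.exists_mapClusterPt
    (f := comap (ellisMap (Equiv.Perm X) (OnePoint X)) (𝓝 f)) (u := c) (by simp)
  exact ⟨p, le_nhds_of_unique_clusterPt fun q hq => eq_of_clusterPt_ellis hc f hq hp⟩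

end

/-! ### Transport along isomorphisms of topological monoids -/

section Transport

variable {G : Type u} [Group G] [TopologicalSpace G] {S : Type v} [Monoid S] [TopologicalSpace S]
  {S' : Type w} [Monoid S'] [TopologicalSpace S'] {b : G → S}

theorem IsEllisCompactification.comp_equiv (hb : IsEllisCompactification b) (φ : S ≃ₜ* S') :
    IsEllisCompactification (φ ∘ b) where
  isGCompactification := by
    obtain ⟨act, ⟨_, _, _, hemb, hd, hsmul⟩, hact⟩ := hb.isGCompactification
    let act' : MulAction G S' :=
      { smul := fun g s => φ (b g) * s
        one_smul := fun s => by
          have h : b 1 * φ.symm s = φ.symm s := by rw [← hact, one_smul]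
          have h' := congrArg φ h
          rwa [map_mul, φ.apply_symm_apply] at h'
        mul_smul := fun g h s => by
          have : b (g * h) = b g * b h := by rw [← hact, ← hsmul, smul_eq_mul]
          change φ (b (g * h)) * s = φ (b g) * (φ (b h) * s)
          rw [this, map_mul, mul_assoc] }
    have hsm : ∀ (g : G) (s : S'), g • s = φ (g • φ.symm s) := fun g s => by
      rw [hact, map_mul, φ.apply_symm_apply]
      rfl
    refine ⟨act', ⟨φ.toHomeomorph.compactSpace, φ.toHomeomorph.t2Space, ⟨?_⟩,
      φ.toHomeomorph.isEmbedding.comp hemb,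
      φ.toHomeomorph.surjective.denseRange.comp hd φ.continuous_toFun, fun g h => ?_⟩,
      fun g s => rfl⟩
    · simp only [hsm]
      exact φ.continuous_toFun.comp
        (continuous_fst.smul (φ.continuous_invFun.comp continuous_snd))
    · change φ (b (g • h)) = φ (b g) * φ (b h)
      rw [hsmul, hact, map_mul]
  continuous_mul_right t := by
    have : (fun s => s * t) = fun s => φ (φ.symm s * φ.symm t) := by
      funext s
      simp
    rw [this]
    exact φ.continuous_toFun.comp
      ((hb.continuous_mul_right _).comp φ.continuous_invFun)

theorem IsSmCompactification.comp_equiv (hb : IsSmCompactification b) (φ : S ≃ₜ* S') :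
    IsSmCompactification (φ ∘ b) where
  toIsEllisCompactification := hb.toIsEllisCompactification.comp_equiv φ
  continuous_mul_left s := by
    have : (fun t => s * t) = fun t => φ (φ.symm s * φ.symm t) := by
      funext t
      simp
    rw [this]
    exact φ.continuous_toFun.comp
      ((hb.continuous_mul_left _).comp φ.continuous_invFun)

theorem IsSimCompactification.comp_equiv (hb : IsSimCompactification b) (φ : S ≃ₜ* S') :
    IsSimCompactification (φ ∘ b) where
  toIsSmCompactification := hb.toIsSmCompactification.comp_equiv φ
  exists_inv := by
    obtain ⟨inv, hinv, h⟩ := hb.exists_inv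
    refine ⟨fun s => φ (inv (φ.symm s)),
      φ.continuous_toFun.comp (hinv.comp φ.continuous_invFun), fun s t => ?_⟩
    obtain ⟨s, rfl⟩ := φ.surjective s
    obtain ⟨t, rfl⟩ := φ.surjective t
    dsimp only
    rw [φ.symm_apply_apply, ← map_mul, ← map_mul, ← map_mul, ← map_mul, φ.injective.eq_iff,
      φ.injective.eq_iff, φ.injective.eq_iff, h]

theorem IsWAPCompactification.comp_equiv (hb : IsWAPCompactification.{u, v, x} b)
    (φ : S ≃ₜ* S') : IsWAPCompactification.{u, w, x} (φ ∘ b) where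
  toIsSmCompactification := hb.toIsSmCompactification.comp_equiv φ
  greatest T _ _ c hc := by
    obtain ⟨ψ, hψ, h⟩ := hb.greatest T c hc
    refine ⟨ψ ∘ φ.symm, hψ.comp φ.continuous_invFun, ?_⟩
    rw [← h]
    funext g
    simp

end Transport

/-! ### The main theorem -/

theorem isWAPCompactification_ellisMap (X : Type u) [Infinite X] [TopologicalSpace X]
    [DiscreteTopology X] :
    IsWAPCompactification.{u, u, w} (ellisMap (Equiv.Perm X) (OnePoint X)) where
  toIsSmCompactification := isSimCompactification_ellisMap.toIsSmCompactification
  greatest _ _ _ _ hc := compactificationLE_ellisMap hc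

theorem theorem4p1 (X : Type u) [Infinite X] [TopologicalSpace X] [DiscreteTopology X] :
    -- `αX` is a `G`-compactification of `X`, and it is the only one up to equivalence
    (IsGCompactification (Equiv.Perm X) (fun x : X => (x : OnePoint X)) ∧
      ∀ (K : Type v) [TopologicalSpace K] [MulAction (Equiv.Perm X) K] (b : X → K),
        IsGCompactification (Equiv.Perm X) b →
          ∃ φ : OnePoint X ≃ₜ K, (∀ x : X, φ (x : OnePoint X) = b x) ∧
            ∀ (g : Equiv.Perm X) (p : OnePoint X), φ (g • p) = g • φ p) ∧
    IsRoelckePrecompact (Equiv.Perm X) ∧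
    -- the underlying set of `e_{αX} G`
    ((EllisCompactification (Equiv.Perm X) (OnePoint X) : Set (Function.End (OnePoint X))) =
      {f | ∃ Y Z : Set X, BijOn f ((fun x : X => (x : OnePoint X)) '' Y)
          ((fun x : X => (x : OnePoint X)) '' Z) ∧
        ∀ p, p ∉ (fun x : X => (x : OnePoint X)) '' Y → f p = OnePoint.infty}) ∧
    -- `e_{αX} G = b_r G` as compactifications of `G`, and the properties of the monoid `b_r G`
    ∃ (_ : Monoid (RoelckeCompactification (Equiv.Perm X)))
      (φ : EllisCompactification (Equiv.Perm X) (OnePoint X) ≃ₜ*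
        RoelckeCompactification (Equiv.Perm X)),
      (∀ g : Equiv.Perm X, φ (ellisMap (Equiv.Perm X) (OnePoint X) g) =
        roelckeMap (Equiv.Perm X) g) ∧
      IsSimCompactification (roelckeMap (Equiv.Perm X)) ∧
      Nonempty (RoelckeCompactification (Equiv.Perm X) ≃* SymmetricInverseSemigroup X) ∧
      IsWAPCompactification.{u, u, w} (roelckeMap (Equiv.Perm X)) := by
  refine ⟨⟨isGCompactification_onePoint, fun K _ _ b hb => exists_onePoint_homeomorph hb⟩,
    isRoelckePrecompact_perm, ?_, ?_⟩
  · ext f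
    exact (mem_ellisCompactification_iff f).trans (isPartialInjection_iff f)
  obtain ⟨φ, hφ⟩ := exists_homeomorph_roelckeCompactification (X := X)
  -- The multiplication of the closure is transported along `φ`, which thereby becomes an
  -- isomorphism of topological monoids.
  let mon : Monoid (RoelckeCompactification (Equiv.Perm X)) := φ.toEquiv.symm.monoid
  let Φ : EllisCompactification (Equiv.Perm X) (OnePoint X) ≃ₜ*
      RoelckeCompactification (Equiv.Perm X) :=
    { φ with
      map_mul' := fun s t => by
        change φ (s * t) = φ (φ.symm (φ s) * φ.symm (φ t))
        rw [φ.symm_apply_apply, φ.symm_apply_apply] }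
  have hΦ : Φ ∘ ellisMap (Equiv.Perm X) (OnePoint X) = roelckeMap (Equiv.Perm X) := funext hφ
  refine ⟨mon, Φ, hφ, ?_, ⟨Φ.toMulEquiv.symm.trans symmetricInverseEquivEllis.symm⟩, ?_⟩
  · rw [← hΦ]
    exact isSimCompactification_ellisMap.comp_equiv Φ
  · rw [← hΦ]
    exact (isWAPCompactification_ellisMap X).comp_equiv Φ
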